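/- **Language.** Programs are the terms of the grammar $$\mathit{Stmt} ::= \mathit{Var}:=\mathit{Exp}\mid \mathit{Stmt};\mathit{Stmt}\mid \mathsf{if}\ \mathit{BExp}\ \mathsf{then}\ \mathit{Stmt}\ \mathsf{else}\ \mathit{Stmt}\mid \mathsf{while}\ \mathit{BExp}\ \mathsf{do}\ \mathit{Stmt},$$ $$\mathit{Exp} ::= \mathit{Var}\mid 1\mid 0\mid \mathit{Exp}+\mathit{Exp}\mid \mathit{Exp}-\mathit{Exp},\qquad \mathit{BExp} ::= \mathsf t\mid \mathsf f\mid \lnot \mathit{BExp}\mid \mathit{BExp}\wedge \mathit{BExp}\mid \mathit{Exp}<\mathit{Exp}\mid \mathit{Exp}==\mathit{Exp}$$ with countably many variables; $\mathsf{Prog}$ comprises the programs of all three sorts. A state in $\mathsf{State}$ is a triple $(h,e_t,b_t)$ with $h:\mathit{Var}\to\mathbb Z$, $e_t\in\mathbb Z$, $b_t\in\{\mathsf t,\mathsf f\}$. Every program denotes a partial function $[\![c]\!]$ on states by the usual big-step semantics, where an integer (Boolean) expression stores its value in $e_t$ (in $b_t$) and changes nothing else, and a loop denotes the least fixed point of its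 unfolding. A set of programs of one sort is *inductively defined* if it is the language of a nonterminal of a regular tree grammar (finitely many sorted nonterminals and productions) over the program constructors. **Recursive interpreters.** A recursive interpreter $\mathtt{interpret}(t,x)$ initializes its local variables from $x$, matches on the top constructor of $t$, which binds program variables to the immediate subprograms of $t$, and runs code chosen by that constructor, built from arbitrary computations on local (non-program) variables, sequencing, conditionals, while-loops, and recursive calls $y=\mathtt{interpret}(c,x')$, where $x'$ is computed from the local variables and $c$ is a fixed composition of program constructors applied to the program variables bound by the match; $t$ and its subprograms are used in no other way. The interpreter is *correct* if, for all $t\in\mathsf{Prog}$ and all states $x,y$, the call $\mathtt{interpret}(t,x)$ terminates and returns $y$ if and only if $[\![t]\!](x)=y$. **Cartesian triples.** A Cartesian triple is $\{t\in C\wedge x\in P\}\ y=\mathtt{interpret}(t,x)\ \{y\in Q\}$ with $C$ an inductively defined set of programs and $P,Q\subseteq\mathsf{State}$. It is true if for all $t\in C$, $x\in P$ every returned $y$ lies in $Q$ (partial correctness). **Cartesian analyses.** A Hoare-style analysis of $\mathtt{interpret}(t,x)$ from $t\in C\wedge x\in P$ uses the rules of Hoare logic for assignment, sequencing, conditionals,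 loops and consequence, with arbitrary predicates as assertions. A recursive call $\mathtt{interpret}(t',x')$ is analysed by unrolling it, without end if necessary (so a proof may be an infinite tree): if the top constructor of $t'$ is known, the corresponding case of the match is analysed; if $t'$ is a variable denoting a subprogram of $t$, all cases are analysed, and within each case the variable is replaced by variables for its immediate subprograms. There is one precondition per call in the unrolled proof; there is no rule splitting a precondition into a disjunction of cases other than the matches and conditionals of the interpreter. The analysis *uses only Cartesian triples* if the precondition of every recursive call $\mathtt{interpret}(t',x')$ met in the course of the unrolling has the form $$t'=f(t_1,\dots,t_j)\ \wedge\ t=f'(t_1,\dots,t_n)\in C\ \wedge\ P'(x',x,t_{j+1},\dots,t_n)\ \wedge\ R(a_1,\dots,a_m,x,t_{j+1},\dots,t_n),$$ where $t_1,\dots,t_n$ denote the subprograms of $t$ named by the pending matches, $f,f'$ are the compositions of constructors so determined, $t_1,\dots,t_j$ are those of them that occur in $t'$, $a_1,\dots,a_m$ are the local variables of the running and the pending invocations, and $P',R$ are arbitrary predicates. In addition, given a collection $\mathcal C\ni C$ of sets of programs, the analysis is *$\mathcal C$-generic* if every triple in it that is not over a recursive call remains valid when $C$ is replaced by any member of $\mathcal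 C$. (The postcondition of a call may be weakened using the particular set $C$.) **Theorem.** Let $\mathtt{interpret}:\mathsf{Prog}\times\mathsf{State}\rightharpoonup\mathsf{State}$ be a correct recursive interpreter. Then there exist an inductively defined set of programs $C$ and sets $P,Q\subseteq\mathsf{State}$ such that the Cartesian triple $$\{t\in C\wedge x\in P\}\ y=\mathtt{interpret}(t,x)\ \{y\in Q\}$$ is true, but for no collection $\mathcal C\ni C$ is it proven by a $\mathcal C$-generic Hoare-style analysis of $\mathtt{interpret}$ that uses only Cartesian triples. In particular this holds when $\mathcal C$ is the collection of all sets of programs, and when $\mathcal C=\{C\}$, where genericity demands nothing beyond validity for $C$ itself. -/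

import Mathlib

namespace CartInterp

/-! ### The imperative language -/

/-- The three kinds of programs: statements, integer expressions, Boolean expressions. -/
inductive Srt : Type
  | stmt
  | exp
  | bexp

/-- The program constructors, indexed by the sort of the program they build.
Program variables are the natural numbers. -/
inductive Op : Srt → Type
  | assign (v : ℕ) : Op .stmt
  | seq : Op .stmt
  | ite : Op .stmt
  | whileDo : Op .stmt
  | var (v : ℕ) : Op .exp
  | one : Op .exp
  | zero : Op .exp
  | add : Op .exp
  | sub : Op .exp
  | tt : Op .bexp
  | ff : Op .bexp
  | not : Op .bexp
  | and : Op .bexp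
  | lt : Op .bexp
  | eq : Op .bexp

/-- The sorts of the immediate subprograms of a constructor. -/
@[reducible] def Op.args : {s : Srt} → Op s → List Srt
  | _, .assign _ => [.exp]
  | _, .seq => [.stmt, .stmt]
  | _, .ite => [.bexp, .stmt, .stmt]
  | _, .whileDo => [.bexp, .stmt]
  | _, .var _ => []
  | _, .one => []
  | _, .zero => []
  | _, .add => [.exp, .exp]
  | _, .sub => [.exp, .exp]
  | _, .tt => []
  | _, .ff => []
  | _, .not => [.bexp]
  | _, .and => [.bexp, .bexp]
  | _, .lt => [.exp, .exp]
  | _, .eq => [.exp, .exp]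

@[reducible] def Op.arity {s : Srt} (o : Op s) : ℕ := o.args.length

@[reducible] def Op.argSort {s : Srt} (o : Op s) (i : Fin o.arity) : Srt := o.args.get i

/-- Well-sorted compositions of program constructors over a family `V` of variables
that stand for programs. -/
inductive Tm (V : Srt → Type) : Srt → Type
  | hole {s : Srt} (v : V s) : Tm V s
  | node {s : Srt} (o : Op s) (ts : (i : Fin o.arity) → Tm V (o.argSort i)) : Tm V s

/-- Programs are the compositions of constructors without variables. -/
abbrev Prog (s : Srt) : Type := Tm (fun _ => Empty) s

/-- Simultaneous substitutions. -/
abbrev Sub (V W : Srt → Type) : Type := (s : Srt) → V s → Tm W s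

/-- Valuations of variables by programs. -/
abbrev Val (V : Srt → Type) : Type := (s : Srt) → V s → Prog s

def Tm.subst {V W : Srt → Type} (θ : Sub V W) : {s : Srt} → Tm V s → Tm W s
  | _, .hole v => θ _ v
  | _, .node o ts => .node o (fun i => (ts i).subst θ)

/-- The variable `w` occurs in a composition of constructors. -/
inductive Tm.Occurs {V : Srt → Type} {r : Srt} (w : V r) : {s : Srt} → Tm V s → Prop
  | hole : Tm.Occurs w (.hole w)
  | node {s : Srt} {o : Op s} {ts : (i : Fin o.arity) → Tm V (o.argSort i)} (i : Fin o.arity) :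
      Tm.Occurs w (ts i) → Tm.Occurs w (.node o ts)

/-- States: values of the program variables, together with the reserved variables that
receive the results of integer and Boolean expressions. -/
@[ext] structure State : Type where
  h : ℕ → ℤ
  et : ℤ
  bt : Bool

/-- `BigStep c σ σ'` says that `c`, run on `σ`, terminates with output state `σ'`. -/
inductive BigStep : {s : Srt} → Prog s → State → State → Prop
  | assign {v ts σ σ₁} : BigStep (ts 0) σ σ₁ →
      BigStep (.node (.assign v) ts) σ { σ with h := Function.update σ.h v σ₁.et }
  | seq {ts σ σ₁ σ₂} : BigStep (ts 0) σ σ₁ → BigStep (ts 1) σ₁ σ₂ →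
      BigStep (.node .seq ts) σ σ₂
  | iteTrue {ts σ σ₁ σ₂} : BigStep (ts 0) σ σ₁ → σ₁.bt = true → BigStep (ts 1) σ σ₂ →
      BigStep (.node .ite ts) σ σ₂
  | iteFalse {ts σ σ₁ σ₂} : BigStep (ts 0) σ σ₁ → σ₁.bt = false → BigStep (ts 2) σ σ₂ →
      BigStep (.node .ite ts) σ σ₂
  | whileTrue {ts σ σ₁ σ₂ σ₃} : BigStep (ts 0) σ σ₁ → σ₁.bt = true → BigStep (ts 1) σ σ₂ →
      BigStep (.node .whileDo ts) σ₂ σ₃ → BigStep (.node .whileDo ts) σ σ₃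
  | whileFalse {ts σ σ₁} : BigStep (ts 0) σ σ₁ → σ₁.bt = false →
      BigStep (.node .whileDo ts) σ σ
  | var {v ts σ} : BigStep (.node (.var v) ts) σ { σ with et := σ.h v }
  | one {ts σ} : BigStep (.node .one ts) σ { σ with et := 1 }
  | zero {ts σ} : BigStep (.node .zero ts) σ { σ with et := 0 }
  | add {ts σ σ₁ σ₂} : BigStep (ts 0) σ σ₁ → BigStep (ts 1) σ σ₂ →
      BigStep (.node .add ts) σ { σ with et := σ₁.et + σ₂.et }
  | sub {ts σ σ₁ σ₂} : BigStep (ts 0) σ σ₁ → BigStep (ts 1) σ σ₂ →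
      BigStep (.node .sub ts) σ { σ with et := σ₁.et - σ₂.et }
  | tt {ts σ} : BigStep (.node .tt ts) σ { σ with bt := true }
  | ff {ts σ} : BigStep (.node .ff ts) σ { σ with bt := false }
  | not {ts σ σ₁} : BigStep (ts 0) σ σ₁ →
      BigStep (.node .not ts) σ { σ with bt := !σ₁.bt }
  | and {ts σ σ₁ σ₂} : BigStep (ts 0) σ σ₁ → BigStep (ts 1) σ σ₂ →
      BigStep (.node .and ts) σ { σ with bt := σ₁.bt && σ₂.bt }
  | lt {ts σ σ₁ σ₂} : BigStep (ts 0) σ σ₁ → BigStep (ts 1) σ σ₂ →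
      BigStep (.node .lt ts) σ { σ with bt := decide (σ₁.et < σ₂.et) }
  | eq {ts σ σ₁ σ₂} : BigStep (ts 0) σ σ₁ → BigStep (ts 1) σ σ₂ →
      BigStep (.node .eq ts) σ { σ with bt := decide (σ₁.et = σ₂.et) }

/-! ### Inductively defined sets of programs -/

structure Production (N : Srt → Type) : Type where
  {s : Srt}
  lhs : N s
  op : Op s
  rhs : (i : Fin op.arity) → N (op.argSort i)

/-- Regular tree grammars over the program constructors; `N s` is the set of nonterminals
of sort `s`. -/
structure RTG : Type 1 where
  N : Srt → Type
  finite_N : Finite (Σ s : Srt, N s)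
  prods : Set (Production N)
  finite_prods : prods.Finite

/-- `G.Gen n t` says that the program `t` is derivable from the nonterminal `n`. -/
inductive RTG.Gen (G : RTG) : {s : Srt} → G.N s → Prog s → Prop
  | mk (p : Production G.N) (hp : p ∈ G.prods) (ts : (i : Fin p.op.arity) → Prog (p.op.argSort i))
      (h : ∀ i, G.Gen (p.rhs i) (ts i)) : G.Gen p.lhs (.node p.op ts)

def InductivelyDefined {τ : Srt} (C : Set (Prog τ)) : Prop :=
  ∃ (G : RTG) (start : G.N τ), C = {t | G.Gen start t}

/-! ### Recursive interpreters -/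

/-- The program variables that a match on the constructor `o` binds: one for each immediate
subprogram. -/
inductive Arg {s : Srt} (o : Op s) : Srt → Type
  | mk (i : Fin o.arity) : Arg o (o.argSort i)

/-- The binding of the matched variables to the immediate subprograms. -/
def Arg.bind {V : Srt → Type} {s : Srt} {o : Op s}
    (ts : (i : Fin o.arity) → Tm V (o.argSort i)) : Sub (Arg o) V
  | _, .mk i => ts i

/-- Imperative code of an interpreter, in which the program-valued variables `V` are in scope.
The interpreter's other local variables form a store of type `S`, on which any computation is
allowed. The variables in `V` are used only to build the program passed to a recursive call:
`call p arg ret` calls the interpreter on the program `p` and the state `arg σ`, where `σ` is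
the current store, and sets the store to `ret σ y`, where `y` is the returned state. -/
inductive Code (V : Srt → Type) (S : Type) : Type
  | skip : Code V S
  | assign (f : S → S) : Code V S
  | seq (c₁ c₂ : Code V S) : Code V S
  | ite (g : S → Bool) (c₁ c₂ : Code V S) : Code V S
  | loop (g : S → Bool) (c : Code V S) : Code V S
  | call {s : Srt} (p : Tm V s) (arg : S → State) (ret : S → State → S) : Code V S

/-- A recursive interpreter. A call `interpret(t, x)` sets up a fresh store `entry x`, matches on
the top constructor of `t`, runs the code given for that constructor, and returns
`result σ`, where `σ` is the final store. -/
structure Interpreter : Type 1 where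
  Store : Type
  entry : State → Store
  result : Store → State
  body : {s : Srt} → (o : Op s) → Code (Arg o) Store

/-- `I.Exec ρ c σ σ'`: with its program variables bound by `ρ`, the code `c` run on the store `σ`
terminates with the store `σ'`. -/
inductive Interpreter.Exec (I : Interpreter) :
    {V : Srt → Type} → Val V → Code V I.Store → I.Store → I.Store → Prop
  | skip {V} {ρ : Val V} {σ} : I.Exec ρ .skip σ σ
  | assign {V} {ρ : Val V} {f σ} : I.Exec ρ (.assign f) σ (f σ)
  | seq {V} {ρ : Val V} {c₁ c₂ σ σ₁ σ₂} : I.Exec ρ c₁ σ σ₁ → I.Exec ρ c₂ σ₁ σ₂ →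
      I.Exec ρ (.seq c₁ c₂) σ σ₂
  | iteTrue {V} {ρ : Val V} {g c₁ c₂ σ σ₁} : g σ = true → I.Exec ρ c₁ σ σ₁ →
      I.Exec ρ (.ite g c₁ c₂) σ σ₁
  | iteFalse {V} {ρ : Val V} {g c₁ c₂ σ σ₁} : g σ = false → I.Exec ρ c₂ σ σ₁ →
      I.Exec ρ (.ite g c₁ c₂) σ σ₁
  | loopTrue {V} {ρ : Val V} {g c σ σ₁ σ₂} : g σ = true → I.Exec ρ c σ σ₁ →
      I.Exec ρ (.loop g c) σ₁ σ₂ → I.Exec ρ (.loop g c) σ σ₂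
  | loopFalse {V} {ρ : Val V} {g c σ} : g σ = false → I.Exec ρ (.loop g c) σ σ
  | call {V} {ρ : Val V} {s : Srt} {p : Tm V s} {arg ret} {o : Op s}
      {ts : (i : Fin o.arity) → Prog (o.argSort i)} {σ σ'} :
      p.subst ρ = .node o ts → I.Exec (Arg.bind ts) (I.body o) (I.entry (arg σ)) σ' →
      I.Exec ρ (.call p arg ret) σ (ret σ (I.result σ'))

/-- The call `interpret(t, x)` terminates and returns `y`. -/
def Interpreter.Returns (I : Interpreter) {s : Srt} (t : Prog s) (x y : State) : Prop :=
  ∃ (o : Op s) (ts : (i : Fin o.arity) → Prog (o.argSort i)) (σ : I.Store),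
    t = .node o ts ∧ I.Exec (Arg.bind ts) (I.body o) (I.entry x) σ ∧ y = I.result σ

/-- The interpreter computes the semantics of every program of every sort; in particular it
diverges exactly when the program does. -/
def Interpreter.Correct (I : Interpreter) : Prop :=
  ∀ (s : Srt) (t : Prog s) (x y : State), I.Returns t x y ↔ BigStep t x y

/-- Truth of the Cartesian triple `{t ∈ C ∧ x ∈ P} y = interpret(t, x) {y ∈ Q}`. -/
def Interpreter.TrueTriple (I : Interpreter) {τ : Srt} (C : Set (Prog τ)) (P Q : Set State) :
    Prop :=
  ∀ t ∈ C, ∀ x ∈ P, ∀ y, I.Returns t x y → y ∈ Q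

/-! ### Hoare-style analysis with Cartesian preconditions

An analysis of `interpret(t, x)` is carried out in a context `V` of variables `t₁, …, tₙ` that
denote the subprograms of `t` to which the matches performed so far have given names; these
matches determine a composition `top` of constructors with `t = top(t₁, …, tₙ)`. -/

/-- Assertions at a point of the unrolled interpreter. They may mention the set `C`, the
subprograms `t₁, …, tₙ`, the initial input `x`, the suspended stores of all pending callers, and
either the store of the running invocation (`X = S`) or the state exchanged with it
(`X = State`). -/
abbrev Assn (τ : Srt) (V : Srt → Type) (S X : Type) : Type :=
  Set (Prog τ) → Val V → State → List S → X → Prop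

/-- The values of those variables that do not occur in `t'`. -/
def rest {V : Srt → Type} {s : Srt} (t' : Tm V s) (ρ : Val V) :
    (r : Srt) → (w : V r) → ¬ t'.Occurs w → Prog r :=
  fun r w _ => ρ r w

/-- The Cartesian precondition
`t' = f(t₁, …, tⱼ) ∧ t = top(t₁, …, tₙ) ∈ C ∧ P(x', x, tⱼ₊₁, …, tₙ) ∧ R(a₁, …, aₘ, x, tⱼ₊₁, …, tₙ)`
of a recursive call `interpret(t', x')` with `x' = arg σ`. Here `f` is the composition of
constructors `t'`, the `t₁, …, tⱼ` are the variables that occur in it, and `a₁, …, aₘ` are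
the local variables of the running invocation and of all pending ones. -/
def cartPre {τ : Srt} {V : Srt → Type} {S : Type} (top : Tm V τ) {s : Srt} (t' : Tm V s)
    (arg : S → State)
    (P : State → State → ((r : Srt) → (w : V r) → ¬ t'.Occurs w → Prog r) → Prop)
    (R : List S → State → ((r : Srt) → (w : V r) → ¬ t'.Occurs w → Prog r) → Prop) :
    Assn τ V S S :=
  fun C ρ x κ σ => top.subst ρ ∈ C ∧ P (arg σ) x (rest t' ρ) ∧ R (σ :: κ) x (rest t' ρ)

/-- A family of triples `{pre} y = interpret(t', x') {post}` over calls of the interpreter. -/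
abbrev CallTriples (τ : Srt) (S : Type) : Type 1 :=
  (V : Srt → Type) → (top : Tm V τ) → (s : Srt) → (t' : Tm V s) →
    (pre post : Assn τ V S State) → Prop

/-- Hoare logic for the code of one invocation of the interpreter, where `θ` gives the values of
the program variables of that invocation in terms of `t₁, …, tₙ`. The triples over recursive
calls have Cartesian preconditions and are taken from `D`. All other reasoning has to be valid
for each set of programs in the collection `𝒞` in place of the analysed set `C`. -/
inductive Deriv {τ : Srt} {S : Type} (𝒞 : Set (Set (Prog τ))) (D : CallTriples τ S)
    {V : Srt → Type} (top : Tm V τ) {W : Srt → Type} (θ : Sub W V) :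
    Assn τ V S S → Code W S → Assn τ V S S → Prop
  | skip {A} : Deriv 𝒞 D top θ A .skip A
  | assign {A f} : Deriv 𝒞 D top θ (fun C ρ x κ σ => A C ρ x κ (f σ)) (.assign f) A
  | seq {A M B c₁ c₂} : Deriv 𝒞 D top θ A c₁ M → Deriv 𝒞 D top θ M c₂ B →
      Deriv 𝒞 D top θ A (.seq c₁ c₂) B
  | ite {A B g c₁ c₂} :
      Deriv 𝒞 D top θ (fun C ρ x κ σ => A C ρ x κ σ ∧ g σ = true) c₁ B →
      Deriv 𝒞 D top θ (fun C ρ x κ σ => A C ρ x κ σ ∧ g σ = false) c₂ B →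
      Deriv 𝒞 D top θ A (.ite g c₁ c₂) B
  | loop {A g c} :
      Deriv 𝒞 D top θ (fun C ρ x κ σ => A C ρ x κ σ ∧ g σ = true) c A →
      Deriv 𝒞 D top θ A (.loop g c) (fun C ρ x κ σ => A C ρ x κ σ ∧ g σ = false)
  | conseq {A A' B B' c} :
      (∀ C ∈ 𝒞, ∀ ρ x κ σ, A C ρ x κ σ → A' C ρ x κ σ) →
      Deriv 𝒞 D top θ A' c B' →
      (∀ C ∈ 𝒞, ∀ ρ x κ σ, B' C ρ x κ σ → B C ρ x κ σ) →
      Deriv 𝒞 D top θ A c B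
  | call {s : Srt} {p : Tm W s} {arg ret P R post} :
      D V top s (p.subst θ)
        (fun C ρ x κ' x' => ∃ σ κ, κ' = σ :: κ ∧ x' = arg σ ∧
          cartPre top (p.subst θ) arg P R C ρ x κ σ)
        post →
      Deriv 𝒞 D top θ (cartPre top (p.subst θ) arg P R) (.call p arg ret)
        (fun C ρ x κ σ' => ∃ σ y, σ' = ret σ y ∧ post C ρ x (σ :: κ) y)

/-- The context in which a match has replaced the variable `v` by the immediate subprograms of
the constructor `o`. -/
inductive Refine {V : Srt → Type} {s : Srt} (v : V s) (o : Op s) : Srt → Type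
  | old {r : Srt} (w : V r) (h : (⟨r, w⟩ : Σ r : Srt, V r) ≠ ⟨s, v⟩) : Refine v o r
  | new (i : Fin o.arity) : Refine v o (o.argSort i)

/-- The composition of constructors `o(t₁', …, tₖ')` of the new variables. -/
def Refine.expand {V : Srt → Type} {s : Srt} (v : V s) (o : Op s) : Tm (Refine v o) s :=
  .node o (fun i => .hole (.new i))

open Classical in
/-- The old variables in terms of the new ones: `v = o(t₁', …, tₖ')`, the others are kept. -/
noncomputable def Refine.sub {V : Srt → Type} {s : Srt} (v : V s) (o : Op s) :
    Sub V (Refine v o) :=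
  fun r w =>
    if h : (⟨r, w⟩ : Σ r : Srt, V r) = ⟨s, v⟩ then
      have e : s = r := (congrArg Sigma.fst h).symm
      e ▸ Refine.expand v o
    else .hole (.old w h)

/-- An assertion in the old context, read in the refined one. -/
noncomputable def Assn.refine {τ : Srt} {V : Srt → Type} {S X : Type} (A : Assn τ V S X)
    {s : Srt} (v : V s) (o : Op s) : Assn τ (Refine v o) S X :=
  fun C ρ x κ z => A C (fun r w => (Refine.sub v o r w).subst ρ) x κ z

/-- The assertion on entry to an invocation, given the precondition of the call. -/
def Interpreter.atEntry (I : Interpreter) {τ : Srt} {V : Srt → Type}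
    (pre : Assn τ V I.Store State) : Assn τ V I.Store I.Store :=
  fun C ρ x κ σ => ∃ x', σ = I.entry x' ∧ pre C ρ x κ x'

/-- The assertion on exit from an invocation, given the postcondition of the call. -/
def Interpreter.atExit (I : Interpreter) {τ : Srt} {V : Srt → Type}
    (post : Assn τ V I.Store State) : Assn τ V I.Store I.Store :=
  fun C ρ x κ σ => post C ρ x κ (I.result σ)

/-- One unrolling of a call: `{pre} y = interpret(t', x') {post}` is derived from derivations for
the code of `interpret`. If the top constructor of `t'` is known, the match selects its case.
If `t'` is one of the variables `t₁, …, tₙ`, every case of the match has to be analysed, and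
the variable is replaced by its immediate subprograms. -/
def Interpreter.Unrolled (I : Interpreter) {τ : Srt} (𝒞 : Set (Set (Prog τ)))
    (D : CallTriples τ I.Store) {V : Srt → Type} (top : Tm V τ) :
    {s : Srt} → Tm V s → (pre post : Assn τ V I.Store State) → Prop
  | _, .node o ts, pre, post =>
      Deriv 𝒞 D top (Arg.bind ts) (I.atEntry pre) (I.body o) (I.atExit post)
  | s, .hole v, pre, post =>
      ∀ o : Op s,
        Deriv 𝒞 D (top.subst (Refine.sub v o)) (Arg.bind fun i => .hole (.new i))
          (I.atEntry (pre.refine v o)) (I.body o) (I.atExit (post.refine v o))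

/-- The context of the initial call: the only program variable is `t`. -/
inductive TopVar (τ : Srt) : Srt → Type
  | t : TopVar τ τ

/-- The triple `{t ∈ C ∧ x ∈ P} y = interpret(t, x) {y ∈ Q}` has a Hoare-style proof that uses
only Cartesian triples: a family `D` of call triples contains it and is closed under unrolling,
so that the recursive calls can be unrolled without end and every precondition of a recursive
call met on the way is Cartesian. (Such a `D` describes a possibly infinite proof tree; the
assumed function summaries of recursive Hoare logic are a special case.)
The final weakening `post'` to `post` of a triple over a call of `interpret` may
use the particular set `C`. Every triple that is not over a call has to hold for each
set in the collection `𝒞` in place of `C`; `𝒞 = Set.univ` demands that it hold for all sets of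
programs, and `𝒞 = {C}` makes no demand beyond its holding for `C` itself. -/
def Interpreter.CartesianProvable (I : Interpreter) {τ : Srt} (𝒞 : Set (Set (Prog τ)))
    (C : Set (Prog τ)) (P Q : Set State) : Prop :=
  ∃ D : CallTriples τ I.Store,
    (∀ (V : Srt → Type) (top : Tm V τ) (s : Srt) (t' : Tm V s)
        (pre post : Assn τ V I.Store State), D V top s t' pre post →
      ∃ post' : Assn τ V I.Store State,
        I.Unrolled 𝒞 D top t' pre post' ∧
          ∀ ρ x κ y, post' C ρ x κ y → post C ρ x κ y) ∧
    D (TopVar τ) (.hole .t) τ (.hole .t)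
      (fun C' ρ x κ x' => ρ τ .t ∈ C' ∧ x ∈ P ∧ x' = x ∧ κ = [])
      (fun _ _ _ _ y => y ∈ Q)

end CartInterp

namespace CartInterp

/-! Take for `C` the set `loops` of the two programs `while x < 2 do x := x + 1` and `while x < 2 do
x := x + 2`, with `x = 0` before and `x = 2` after. The triple is true because one and the same body
is run throughout. When the interpreter calls itself on the variable for the loop body, however, a
Cartesian precondition speaks of the guard, the local variables and membership of the whole program
in `loops`, but not of the body itself: if it holds for one of the two bodies, it holds for the
other. A proof must therefore allow for a new choice of body at each such call, and so also covers a
run that adds 1 and then 2. That is the run of the loop with body `mixedStep`, which is not in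
`loops` and ends with `x = 3`.

As the interpreter is arbitrary, `deriv_mixed` follows its execution on the mixed loop and carries
the assertions along under a valuation that always names one of the two real bodies but may switch
at calls of the body variable. Calls on a term with known top constructor are followed by induction;
at a call on a variable, `cartPre.congr` permits the switch and `returns_sound` yields the
postcondition. Of the collection `𝒞` only `C ∈ 𝒞` is used. -/

theorem Tm.subst_subst {U V W : Srt → Type} (θ : Sub U V) (η : Sub V W) {s : Srt} (p : Tm U s) :
    (p.subst θ).subst η = p.subst (fun r u => (θ r u).subst η) := by
  induction p with
  | hole v => rfl
  | node o ts ih => simp only [Tm.subst, ih]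

/-! ### Inversion of Hoare derivations modulo the consequence rule -/

section Inversion

variable {τ : Srt} {S : Type} {𝒞 : Set (Set (Prog τ))} {D : CallTriples τ S}
  {V W : Srt → Type} {top : Tm V τ} {θ : Sub W V} {A B : Assn τ V S S} {C : Set (Prog τ)}
  {ρ : Val V} {x : State} {κ : List S} {σ : S}

theorem Deriv.skip_inv (h : Deriv 𝒞 D top θ A .skip B) (hC : C ∈ 𝒞) (hA : A C ρ x κ σ) :
    B C ρ x κ σ := by
  generalize hc : Code.skip = c at h
  induction h with
  | conseq h₁ _ h₂ ih => exact h₂ _ hC _ _ _ _ (ih (h₁ _ hC _ _ _ _ hA) hc)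
  | skip => exact hA
  | _ => cases hc

theorem Deriv.assign_inv {f : S → S} (h : Deriv 𝒞 D top θ A (.assign f) B) (hC : C ∈ 𝒞)
    (hA : A C ρ x κ σ) : B C ρ x κ (f σ) := by
  generalize hc : Code.assign f = c at h
  induction h with
  | conseq h₁ _ h₂ ih => exact h₂ _ hC _ _ _ _ (ih (h₁ _ hC _ _ _ _ hA) hc)
  | assign => cases hc; exact hA
  | _ => cases hc

theorem Deriv.seq_inv {c₁ c₂ : Code W S} (h : Deriv 𝒞 D top θ A (.seq c₁ c₂) B) :
    ∃ M, Deriv 𝒞 D top θ A c₁ M ∧ Deriv 𝒞 D top θ M c₂ B := by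
  generalize hc : Code.seq c₁ c₂ = c at h
  induction h with
  | conseq h₁ _ h₂ ih =>
    obtain ⟨M, hM₁, hM₂⟩ := ih hc
    exact ⟨M, .conseq h₁ hM₁ fun _ _ _ _ _ _ h => h, .conseq (fun _ _ _ _ _ _ h => h) hM₂ h₂⟩
  | seq h₁ h₂ => cases hc; exact ⟨_, h₁, h₂⟩
  | _ => cases hc

theorem Deriv.ite_inv {g : S → Bool} {c₁ c₂ : Code W S}
    (h : Deriv 𝒞 D top θ A (.ite g c₁ c₂) B) :
    Deriv 𝒞 D top θ (fun C ρ x κ σ => A C ρ x κ σ ∧ g σ = true) c₁ B ∧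
      Deriv 𝒞 D top θ (fun C ρ x κ σ => A C ρ x κ σ ∧ g σ = false) c₂ B := by
  generalize hc : Code.ite g c₁ c₂ = c at h
  induction h with
  | conseq h₁ _ h₂ ih =>
    obtain ⟨hM₁, hM₂⟩ := ih hc
    exact ⟨.conseq (fun _ hC _ _ _ _ h => ⟨h₁ _ hC _ _ _ _ h.1, h.2⟩) hM₁ h₂,
      .conseq (fun _ hC _ _ _ _ h => ⟨h₁ _ hC _ _ _ _ h.1, h.2⟩) hM₂ h₂⟩
  | ite h₁ h₂ => cases hc; exact ⟨h₁, h₂⟩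
  | _ => cases hc

/-- Consequence steps may separate the loop's pre- and postcondition from its invariant, so the
invariant `M` has to be recovered existentially. -/
theorem Deriv.loop_inv {g : S → Bool} {c₀ : Code W S} (h : Deriv 𝒞 D top θ A (.loop g c₀) B) :
    ∃ M : Assn τ V S S, (∀ C ∈ 𝒞, ∀ ρ x κ σ, A C ρ x κ σ → M C ρ x κ σ) ∧
      Deriv 𝒞 D top θ (fun C ρ x κ σ => M C ρ x κ σ ∧ g σ = true) c₀ M ∧
      ∀ C ∈ 𝒞, ∀ ρ x κ σ, M C ρ x κ σ → g σ = false → B C ρ x κ σ := by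
  generalize hc : Code.loop g c₀ = c at h
  induction h with
  | conseq h₁ _ h₂ ih =>
    obtain ⟨M, hA, hM, hB⟩ := ih hc
    exact ⟨M, fun _ hC _ _ _ _ h => hA _ hC _ _ _ _ (h₁ _ hC _ _ _ _ h), hM,
      fun _ hC _ _ _ _ h hg => h₂ _ hC _ _ _ _ (hB _ hC _ _ _ _ h hg)⟩
  | @loop A _ _ h => cases hc; exact ⟨A, fun _ _ _ _ _ _ h => h, h, fun _ _ _ _ _ _ h hg => ⟨h, hg⟩⟩
  | _ => cases hc

theorem Deriv.call_inv {s : Srt} {p : Tm W s} {arg : S → State} {ret : S → State → S}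
    (h : Deriv 𝒞 D top θ A (.call p arg ret) B) :
    ∃ P R post, D V top s (p.subst θ)
        (fun C ρ x κ' x' => ∃ σ κ, κ' = σ :: κ ∧ x' = arg σ ∧
          cartPre top (p.subst θ) arg P R C ρ x κ σ) post ∧
      (∀ C ∈ 𝒞, ∀ ρ x κ σ, A C ρ x κ σ → cartPre top (p.subst θ) arg P R C ρ x κ σ) ∧
      ∀ C ∈ 𝒞, ∀ ρ x κ σ y, post C ρ x (σ :: κ) y → B C ρ x κ (ret σ y) := by
  generalize hc : Code.call p arg ret = c at h
  induction h with
  | conseq h₁ _ h₂ ih =>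
    obtain ⟨P, R, post, hD, hA, hB⟩ := ih hc
    exact ⟨P, R, post, hD, fun _ hC _ _ _ _ h => hA _ hC _ _ _ _ (h₁ _ hC _ _ _ _ h),
      fun _ hC _ _ _ _ _ h => h₂ _ hC _ _ _ _ (hB _ hC _ _ _ _ _ h)⟩
  | @call _ _ _ _ P R post h =>
    cases hc
    exact ⟨P, R, post, h, fun _ _ _ _ _ _ h => h, fun _ _ _ _ _ _ _ h => ⟨_, _, rfl, h⟩⟩
  | _ => cases hc

/-- A Cartesian precondition is insensitive to the programs occurring in the called term. -/
theorem cartPre.congr {s : Srt} {t' : Tm V s} {arg : S → State}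
    {P : State → State → ((r : Srt) → (w : V r) → ¬ t'.Occurs w → Prog r) → Prop}
    {R : List S → State → ((r : Srt) → (w : V r) → ¬ t'.Occurs w → Prog r) → Prop}
    {ρ' : Val V} (h : cartPre top t' arg P R C ρ x κ σ) (hC : top.subst ρ' ∈ C)
    (hρ : ∀ r (w : V r), ¬ t'.Occurs w → ρ' r w = ρ r w) :
    cartPre top t' arg P R C ρ' x κ σ := by
  have e : rest t' ρ' = rest t' ρ := by
    funext r w hw
    exact hρ r w hw
  exact ⟨hC, e ▸ h.2.1, e ▸ h.2.2⟩

end Inversion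

/-! ### Change of context at a match -/

section Refinement

variable {V : Srt → Type} {s : Srt} {v : V s} {o : Op s}

/-- The valuation that extends `ρ` to the immediate subprograms `ts` of the value of `v`. -/
def Refine.val (ρ : Val V) (ts : (i : Fin o.arity) → Prog (o.argSort i)) : Val (Refine v o)
  | _, .old w _ => ρ _ w
  | _, .new i => ts i

theorem Refine.sub_self : Refine.sub v o s v = Refine.expand v o := by
  simp [Refine.sub]

/-- Lets assertions pass between the contexts before and after a match: expanding `v` and then
evaluating the new variables restores the old valuation. -/
theorem Refine.sub_subst_val {ρ : Val V} {ts : (i : Fin o.arity) → Prog (o.argSort i)}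
    (h : ρ s v = .node o ts) (r : Srt) (w : V r) :
    (Refine.sub v o r w).subst (Refine.val ρ ts) = ρ r w := by
  by_cases hw : (⟨r, w⟩ : Σ r : Srt, V r) = ⟨s, v⟩
  · cases hw
    rw [Refine.sub_self, h]
    rfl
  · rw [Refine.sub, dif_neg hw]
    rfl

end Refinement

/-- The call triples `D` are closed under unrolling, where the last weakening of a postcondition
may use the set `C`. -/
def Interpreter.ClosedTriples (I : Interpreter) {τ : Srt} (𝒞 : Set (Set (Prog τ)))
    (C : Set (Prog τ)) (D : CallTriples τ I.Store) : Prop :=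
  ∀ (V : Srt → Type) (top : Tm V τ) (s : Srt) (t' : Tm V s) (pre post : Assn τ V I.Store State),
    D V top s t' pre post →
      ∃ post' : Assn τ V I.Store State, I.Unrolled 𝒞 D top t' pre post' ∧
        ∀ ρ x κ y, post' C ρ x κ y → post C ρ x κ y

/-! ### Soundness, and soundness for mixed runs -/

section Soundness

variable {I : Interpreter} {τ : Srt} {𝒞 : Set (Set (Prog τ))} {C : Set (Prog τ)}
  {D : CallTriples τ I.Store}

/-- Unrolling a call is sound if derivations for the code that the call runs are. -/
theorem Interpreter.ClosedTriples.call_sound (hD : I.ClosedTriples 𝒞 C D)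
    {s : Srt} {o : Op s} {ts : (i : Fin o.arity) → Prog (o.argSort i)} {x' : State}
    {σ' : I.Store}
    -- Assumed here so that the lemma serves both the call case of the induction in `deriv_sound`
    -- and, later, `returns_sound`.
    (body_sound : ∀ {V : Srt → Type} {top : Tm V τ} {θ : Sub (Arg o) V} {ρ : Val V}
      {A B : Assn τ V I.Store I.Store} {x κ}, (∀ r w, (θ r w).subst ρ = Arg.bind ts r w) →
      Deriv 𝒞 D top θ A (I.body o) B → A C ρ x κ (I.entry x') → B C ρ x κ σ')
    {V : Srt → Type} {top : Tm V τ} {q : Tm V s} {pre post : Assn τ V I.Store State}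
    (h : D V top s q pre post) {ρ : Val V} (hq : q.subst ρ = .node o ts)
    {x : State} {κ : List I.Store} (hpre : pre C ρ x κ x') : post C ρ x κ (I.result σ') := by
  obtain ⟨post', hU, hpost⟩ := hD _ _ _ _ _ _ h
  apply hpost
  cases q with
  | node o' ts' =>
    cases hq
    refine body_sound ?_ hU ⟨x', rfl, hpre⟩
    rintro r ⟨i⟩
    rfl
  | hole v =>
    have e : (fun r w => (Refine.sub v o r w).subst (Refine.val ρ ts)) = ρ := by
      funext r w
      exact Refine.sub_subst_val (ρ := ρ) hq r w
    -- All cases of the match have been analysed; the one for the actual top constructor `o` is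
    -- selected.
    have key := body_sound (ρ := Refine.val ρ ts) (x := x) (κ := κ) ?_ (hU o)
      ⟨x', rfl, by rw [Assn.refine, e]; exact hpre⟩
    · rwa [Interpreter.atExit, Assn.refine, e] at key
    · rintro r ⟨i⟩
      rfl

/-- The induction is on the execution: the proof tree may be infinite, but a terminating run unrolls
only finitely many calls. The context is quantified inside, since a call on a variable refines it.
-/
theorem Interpreter.ClosedTriples.deriv_sound (hD : I.ClosedTriples 𝒞 C D) (hC : C ∈ 𝒞)
    {W : Srt → Type} {ρW : Val W} {c : Code W I.Store} {σ σ' : I.Store}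
    (h : I.Exec ρW c σ σ') :
    ∀ {V : Srt → Type} {top : Tm V τ} {θ : Sub W V} {ρ : Val V}
      {A B : Assn τ V I.Store I.Store} {x κ}, (∀ r w, (θ r w).subst ρ = ρW r w) →
      Deriv 𝒞 D top θ A c B → A C ρ x κ σ → B C ρ x κ σ' := by
  induction h with
  | skip => intro V top θ ρ A B x κ _ hd hA; exact hd.skip_inv hC hA
  | assign => intro V top θ ρ A B x κ _ hd hA; exact hd.assign_inv hC hA
  | seq _ _ ih₁ ih₂ =>
    intro V top θ ρ A B x κ hθ hd hA
    obtain ⟨M, h₁, h₂⟩ := hd.seq_inv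
    exact ih₂ hθ h₂ (ih₁ hθ h₁ hA)
  | iteTrue hg _ ih =>
    intro V top θ ρ A B x κ hθ hd hA
    exact ih hθ hd.ite_inv.1 ⟨hA, hg⟩
  | iteFalse hg _ ih =>
    intro V top θ ρ A B x κ hθ hd hA
    exact ih hθ hd.ite_inv.2 ⟨hA, hg⟩
  | loopTrue hg _ _ ih₁ ih₂ =>
    intro V top θ ρ A B x κ hθ hd hA
    obtain ⟨M, hAM, hM, hMB⟩ := hd.loop_inv
    -- The loop rule is applied afresh from the invariant, to treat the remaining iterations.
    exact ih₂ hθ (.conseq (fun _ _ _ _ _ _ h => h) (.loop hM)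
      fun C hC _ _ _ _ h => hMB C hC _ _ _ _ h.1 h.2) (ih₁ hθ hM ⟨hAM _ hC _ _ _ _ hA, hg⟩)
  | loopFalse hg =>
    intro V top θ ρ A B x κ hθ hd hA
    obtain ⟨M, hAM, hM, hMB⟩ := hd.loop_inv
    exact hMB _ hC _ _ _ _ (hAM _ hC _ _ _ _ hA) hg
  | @call _ _ _ p _ _ _ _ _ _ hp _ ih =>
    intro V top θ ρ A B x κ hθ hd hA
    obtain ⟨P, R, post, hcall, hpre, hpost⟩ := hd.call_inv
    refine hpost _ hC _ _ _ _ _ (hD.call_sound ih hcall ?_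
      ⟨_, _, rfl, rfl, hpre _ hC _ _ _ _ hA⟩)
    rw [Tm.subst_subst, ← hp]
    congr 1
    funext r w
    exact hθ r w

/-- Call triples hold of all calls that return. -/
theorem Interpreter.ClosedTriples.returns_sound (hD : I.ClosedTriples 𝒞 C D) (hC : C ∈ 𝒞)
    {V : Srt → Type} {top : Tm V τ} {s : Srt} {q : Tm V s} {pre post : Assn τ V I.Store State}
    (h : D V top s q pre post) {ρ : Val V} {x x' y : State} {κ : List I.Store}
    (hr : I.Returns (q.subst ρ) x' y) (hpre : pre C ρ x κ x') : post C ρ x κ y := by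
  obtain ⟨o, ts, σ, hq, he, rfl⟩ := hr
  exact hD.call_sound (hD.deriv_sound hC he) h hq hpre

/-- Cartesian derivations cannot tell the run of the interpreter under the valuation `ρ₀` from a
run in which, at every call of a program variable, its value is exchanged for one that behaves
like its value under `ρ₀` on the argument of this call. -/
theorem Interpreter.ClosedTriples.deriv_mixed (hD : I.ClosedTriples 𝒞 C D) (hC : C ∈ 𝒞)
    {V : Srt → Type} {top : Tm V τ} {ρ₀ : Val V} {M : Set (Val V)}
    (hMC : ∀ ρ ∈ M, top.subst ρ ∈ C)
    (hM : ∀ ρ ∈ M, ∀ (s : Srt) (v : V s) (x y : State), I.Returns (ρ₀ s v) x y →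
      ∃ ρ' ∈ M, I.Returns (ρ' s v) x y ∧
        ∀ r (w : V r), ¬ (Tm.hole v).Occurs w → ρ' r w = ρ r w)
    {W : Srt → Type} {ρW : Val W} {c : Code W I.Store} {σ σ' : I.Store}
    (h : I.Exec ρW c σ σ') :
    ∀ {θ : Sub W V} {A B : Assn τ V I.Store I.Store} {x κ} {ρ : Val V},
      (∀ r w, (θ r w).subst ρ₀ = ρW r w) → Deriv 𝒞 D top θ A c B → ρ ∈ M → A C ρ x κ σ →
      ∃ ρ' ∈ M, B C ρ' x κ σ' := by
  induction h with
  | skip => intro θ A B x κ ρ _ hd hρ hA; exact ⟨ρ, hρ, hd.skip_inv hC hA⟩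
  | assign => intro θ A B x κ ρ _ hd hρ hA; exact ⟨ρ, hρ, hd.assign_inv hC hA⟩
  | seq _ _ ih₁ ih₂ =>
    intro θ A B x κ ρ hθ hd hρ hA
    obtain ⟨N, h₁, h₂⟩ := hd.seq_inv
    obtain ⟨ρ', hρ', hN⟩ := ih₁ hθ h₁ hρ hA
    exact ih₂ hθ h₂ hρ' hN
  | iteTrue hg _ ih =>
    intro θ A B x κ ρ hθ hd hρ hA
    exact ih hθ hd.ite_inv.1 hρ ⟨hA, hg⟩
  | iteFalse hg _ ih =>
    intro θ A B x κ ρ hθ hd hρ hA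
    exact ih hθ hd.ite_inv.2 hρ ⟨hA, hg⟩
  | loopTrue hg _ _ ih₁ ih₂ =>
    intro θ A B x κ ρ hθ hd hρ hA
    obtain ⟨N, hAN, hN, hNB⟩ := hd.loop_inv
    obtain ⟨ρ', hρ', hN'⟩ := ih₁ hθ hN hρ ⟨hAN _ hC _ _ _ _ hA, hg⟩
    exact ih₂ hθ (.conseq (fun _ _ _ _ _ _ h => h) (.loop hN)
      fun C hC _ _ _ _ h => hNB C hC _ _ _ _ h.1 h.2) hρ' hN'
  | loopFalse hg =>
    intro θ A B x κ ρ hθ hd hρ hA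
    obtain ⟨N, hAN, hN, hNB⟩ := hd.loop_inv
    exact ⟨ρ, hρ, hNB _ hC _ _ _ _ (hAN _ hC _ _ _ _ hA) hg⟩
  | @call _ _ _ p arg _ o ts σ σ' hp he ih =>
    intro θ A B x κ ρ hθ hd hρ hA
    obtain ⟨P, R, post, hcall, hpre, hpost⟩ := hd.call_inv
    have hq : (p.subst θ).subst ρ₀ = .node o ts := by
      rw [Tm.subst_subst, ← hp]
      congr 1
      funext r w
      exact hθ r w
    have hcart := hpre _ hC _ _ _ _ hA
    suffices ∃ ρ' ∈ M, post C ρ' x (σ :: κ) (I.result σ') by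
      obtain ⟨ρ', hρ', h'⟩ := this
      exact ⟨ρ', hρ', hpost _ hC _ _ _ _ _ h'⟩
    clear hpre hpost hp
    generalize p.subst θ = q at *
    cases q with
    | node o' ts' =>
      cases hq
      -- With the top constructor known, unrolling keeps the context, so `M` and `ρ₀` still fit and
      -- the induction hypothesis applies.
      obtain ⟨post', hU, hpost'⟩ := hD _ _ _ _ _ _ hcall
      obtain ⟨ρ', hρ', h'⟩ := ih (by rintro r ⟨i⟩; rfl) hU hρ
        ⟨_, rfl, σ, κ, rfl, rfl, hcart⟩
      exact ⟨ρ', hρ', hpost' _ _ _ _ h'⟩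
    | hole v =>
      -- The run under `ρ₀` is exchanged for one with the same result under `ρ'`; plain soundness
      -- covers the latter, so the inside of this call need not be followed.
      obtain ⟨ρ', hρ', hr, hrest⟩ := hM ρ hρ _ v (arg σ) _ ⟨o, ts, σ', hq, he, rfl⟩
      exact ⟨ρ', hρ', hD.returns_sound hC hcall hr
        ⟨σ, κ, rfl, rfl, hcart.congr (hMC ρ' hρ') hrest⟩⟩

end Soundness

end CartInterp

namespace CartInterp

/-! ### The two counting loops -/

namespace CountingLoops

/-- The nonterminals of the grammar of the two loops. -/
inductive NT : Srt → Type
  | loop : NT .stmt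
  | guard : NT .bexp
  | step : NT .stmt
  | sum : NT .exp
  | var : NT .exp
  | one : NT .exp
  | two : NT .exp

theorem finite_nt : Finite (Σ s : Srt, NT s) := by
  refine Set.finite_univ_iff.mp (Set.Finite.subset (Set.toFinite
    {⟨_, .loop⟩, ⟨_, .guard⟩, ⟨_, .step⟩, ⟨_, .sum⟩, ⟨_, .var⟩, ⟨_, .one⟩, ⟨_, .two⟩}) ?_)
  rintro ⟨_, _ | _⟩ - <;> simp

/-- The immediate subprograms of a constructor with one or two arguments. -/
abbrev args₁ {F : Srt → Type} {s : Srt} (a : F s) : (i : Fin 1) → F ([s].get i)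
  | 0 => a

abbrev args₂ {F : Srt → Type} {r s : Srt} (a : F r) (b : F s) : (i : Fin 2) → F ([r, s].get i)
  | 0 => a
  | 1 => b

abbrev args₃ {F : Srt → Type} {q r s : Srt} (a : F q) (b : F r) (c : F s) :
    (i : Fin 3) → F ([q, r, s].get i)
  | 0 => a
  | 1 => b
  | 2 => c

abbrev args₀ {F : Srt → Type} (i : Fin 0) : F (([] : List Srt).get i) := i.elim0

/-- The grammar of the programs `while x < 1 + 1 do x := x + 1` and
`while x < 1 + 1 do x := x + (1 + 1)`. -/
def grammar : RTG where
  N := NT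
  finite_N := finite_nt
  prods := {⟨.loop, .whileDo, args₂ .guard .step⟩, ⟨.guard, .lt, args₂ .var .two⟩,
    ⟨.step, .assign 0, args₁ .sum⟩, ⟨.sum, .add, args₂ .var .one⟩, ⟨.sum, .add, args₂ .var .two⟩,
    ⟨.var, .var 0, args₀⟩, ⟨.one, .one, args₀⟩, ⟨.two, .add, args₂ .one .one⟩}
  finite_prods := Set.toFinite _

def loops : Set (Prog .stmt) := {t | grammar.Gen NT.loop t}

abbrev x : Prog .exp := .node (.var 0) args₀
abbrev one : Prog .exp := .node .one args₀
abbrev two : Prog .exp := .node .add (args₂ one one)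
abbrev guard : Prog .bexp := .node .lt (args₂ x two)
/-- `x := x + e` -/
abbrev incr (e : Prog .exp) : Prog .stmt := .node (.assign 0) (args₁ (.node .add (args₂ x e)))
/-- `while x < 1 + 1 do s` -/
abbrev loop (s : Prog .stmt) : Prog .stmt := .node .whileDo (args₂ guard s)
/-- `if x < 1 then x := x + 1 else x := x + (1 + 1)` -/
abbrev mixedStep : Prog .stmt :=
  .node .ite (args₃ (.node .lt (args₂ x one)) (incr one) (incr two))

/-- The programs that the nonterminals derive. -/
def Derives : {s : Srt} → NT s → Prog s → Prop
  | _, .loop, t => t = loop (incr one) ∨ t = loop (incr two)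
  | _, .guard, t => t = guard
  | _, .step, t => t = incr one ∨ t = incr two
  | _, .sum, t => t = .node .add (args₂ x one) ∨ t = .node .add (args₂ x two)
  | _, .var, t => t = x
  | _, .one, t => t = one
  | _, .two, t => t = two

/-! ### The language of the grammar -/

theorem args₀_eq {F : Srt → Type} (ts : (i : Fin 0) → F (([] : List Srt).get i)) :
    ts = args₀ := funext fun i => i.elim0

theorem args₁_eq {F : Srt → Type} {s : Srt} (ts : (i : Fin 1) → F ([s].get i)) :
    ts = args₁ (ts 0) := by
  funext i
  match i with
  | 0 => rfl

theorem args₂_eq {F : Srt → Type} {r s : Srt} (ts : (i : Fin 2) → F ([r, s].get i)) :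
    ts = args₂ (ts 0) (ts 1) := by
  funext i
  match i with
  | 0 => rfl
  | 1 => rfl

theorem derives_of_gen {s : Srt} {n : grammar.N s} {t : Prog s} (h : grammar.Gen n t) :
    Derives n t := by
  induction h with
  | mk p hp ts _ ih =>
    rcases hp with rfl | rfl | rfl | rfl | rfl | rfl | rfl | rfl
    · have h₀ : ts 0 = guard := ih 0
      have h₁ : ts 1 = incr one ∨ ts 1 = incr two := ih 1
      rw [args₂_eq ts, h₀]
      exact h₁.imp (fun h => by rw [h]; rfl) (fun h => by rw [h]; rfl)
    · have h₀ : ts 0 = x := ih 0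
      have h₁ : ts 1 = two := ih 1
      rw [args₂_eq ts, h₀, h₁]
      rfl
    · have h₀ : ts 0 = .node .add (args₂ x one) ∨ ts 0 = .node .add (args₂ x two) := ih 0
      rw [args₁_eq ts]
      exact h₀.imp (fun h => by rw [h]; rfl) (fun h => by rw [h]; rfl)
    · have h₀ : ts 0 = x := ih 0
      have h₁ : ts 1 = one := ih 1
      rw [args₂_eq ts, h₀, h₁]
      exact .inl rfl
    · have h₀ : ts 0 = x := ih 0
      have h₁ : ts 1 = two := ih 1
      rw [args₂_eq ts, h₀, h₁]
      exact .inr rfl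
    · rw [args₀_eq ts]
      rfl
    · rw [args₀_eq ts]
      rfl
    · have h₀ : ts 0 = one := ih 0
      have h₁ : ts 1 = one := ih 1
      rw [args₂_eq ts, h₀, h₁]
      rfl

theorem gen_intro {s : Srt} {n : NT s} {o : Op s} {ns : (i : Fin o.arity) → NT (o.argSort i)}
    (hp : (⟨n, o, ns⟩ : Production NT) ∈ grammar.prods)
    {ts : (i : Fin o.arity) → Prog (o.argSort i)} (h : ∀ i, grammar.Gen (ns i) (ts i)) :
    grammar.Gen n (.node o ts) :=
  RTG.Gen.mk (G := grammar) (⟨n, o, ns⟩ : Production NT) hp ts h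

theorem gen_var : grammar.Gen NT.var x :=
  gen_intro (ns := args₀) (.inr (.inr (.inr (.inr (.inr (.inl rfl)))))) fun i => i.elim0

theorem gen_one : grammar.Gen NT.one one :=
  gen_intro (ns := args₀) (.inr (.inr (.inr (.inr (.inr (.inr (.inl rfl))))))) fun i => i.elim0

theorem gen_two : grammar.Gen NT.two two :=
  gen_intro (ns := args₂ .one .one) (.inr (.inr (.inr (.inr (.inr (.inr (.inr (Set.mem_singleton _))))))))
    fun | 0 => gen_one | 1 => gen_one

theorem gen_guard : grammar.Gen NT.guard guard :=
  gen_intro (ns := args₂ .var .two) (.inr (.inl rfl))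
    fun | 0 => gen_var | 1 => gen_two

theorem gen_incr {e : Prog .exp} (h : grammar.Gen NT.sum (.node .add (args₂ x e))) :
    grammar.Gen NT.step (incr e) :=
  gen_intro (ns := args₁ .sum) (.inr (.inr (.inl rfl))) fun | 0 => h

theorem gen_loop {s : Prog .stmt} (h : grammar.Gen NT.step s) : loop s ∈ loops :=
  gen_intro (n := NT.loop) (ns := args₂ .guard .step) (.inl rfl)
    fun | 0 => gen_guard | 1 => h

theorem loop_one_mem : loop (incr one) ∈ loops :=
  gen_loop (gen_incr (gen_intro (ns := args₂ .var .one) (.inr (.inr (.inr (.inl rfl))))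
    fun | 0 => gen_var | 1 => gen_one))

theorem loop_two_mem : loop (incr two) ∈ loops :=
  gen_loop (gen_incr (gen_intro (ns := args₂ .var .two) (.inr (.inr (.inr (.inr (.inl rfl)))))
    fun | 0 => gen_var | 1 => gen_two))

/-! ### Runs of the loops -/

variable {σ σ' : State}

theorem bigStep_x : BigStep x σ σ' ↔ σ' = { σ with et := σ.h 0 } :=
  ⟨by rintro ⟨⟩; rfl, by rintro rfl; exact .var⟩

theorem bigStep_one : BigStep one σ σ' ↔ σ' = { σ with et := 1 } :=
  ⟨by rintro ⟨⟩; rfl, by rintro rfl; exact .one⟩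

theorem bigStep_add {a b : Prog .exp} {m n : ℤ}
    (ha : ∀ σ', BigStep a σ σ' ↔ σ' = { σ with et := m })
    (hb : ∀ σ', BigStep b σ σ' ↔ σ' = { σ with et := n }) :
    BigStep (.node .add (args₂ a b)) σ σ' ↔ σ' = { σ with et := m + n } := by
  constructor
  · intro h
    cases h with
    | add h₀ h₁ =>
      rw [(ha _).1 h₀, (hb _).1 h₁]
  · rintro rfl
    exact .add (ts := args₂ a b) ((ha _).2 rfl) ((hb _).2 rfl)

theorem bigStep_lt {a b : Prog .exp} {m n : ℤ}
    (ha : ∀ σ', BigStep a σ σ' ↔ σ' = { σ with et := m })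
    (hb : ∀ σ', BigStep b σ σ' ↔ σ' = { σ with et := n }) :
    BigStep (.node .lt (args₂ a b)) σ σ' ↔ σ' = { σ with bt := decide (m < n) } := by
  constructor
  · intro h
    cases h with
    | lt h₀ h₁ =>
      rw [(ha _).1 h₀, (hb _).1 h₁]
  · rintro rfl
    exact .lt (ts := args₂ a b) ((ha _).2 rfl) ((hb _).2 rfl)

theorem bigStep_two : BigStep two σ σ' ↔ σ' = { σ with et := 2 } :=
  bigStep_add (fun _ => bigStep_one) fun _ => bigStep_one

theorem bigStep_guard : BigStep guard σ σ' ↔ σ' = { σ with bt := decide (σ.h 0 < 2) } :=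
  bigStep_lt (fun _ => bigStep_x) fun _ => bigStep_two

/-- The state `σ` with `n` added to the variable `x`. -/
def shift (n : ℤ) (σ : State) : State :=
  { σ with h := Function.update σ.h 0 (σ.h 0 + n) }

@[simp] theorem shift_h_zero (n : ℤ) : (shift n σ).h 0 = σ.h 0 + n := by
  simp [shift]

theorem bigStep_incr {e : Prog .exp} {n : ℤ}
    (he : ∀ σ', BigStep e σ σ' ↔ σ' = { σ with et := n }) :
    BigStep (incr e) σ σ' ↔ σ' = shift n σ := by
  have hsum : ∀ σ', BigStep (.node .add (args₂ x e)) σ σ' ↔ σ' = { σ with et := σ.h 0 + n } :=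
    fun _ => bigStep_add (fun _ => bigStep_x) he
  constructor
  · intro h
    cases h with
    | assign h₀ => rw [(hsum _).1 h₀]; rfl
  · rintro rfl
    exact .assign (v := 0) (ts := args₁ (F := Prog) (.node .add (args₂ x e))) ((hsum _).2 rfl)

theorem bigStep_loop_invariant {s : Prog .stmt} {J : ℤ → Prop}
    (hJ : ∀ σ σ', J (σ.h 0) → σ.h 0 < 2 → BigStep s σ σ' → J (σ'.h 0))
    (h : BigStep (loop s) σ σ') : J (σ.h 0) → J (σ'.h 0) ∧ 2 ≤ σ'.h 0 := by
  suffices H : ∀ {r : Srt} {t : Prog r} {σ σ' : State}, BigStep t σ σ' →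
      (⟨r, t⟩ : Σ r, Prog r) = ⟨.stmt, loop s⟩ → J (σ.h 0) → J (σ'.h 0) ∧ 2 ≤ σ'.h 0 from H h rfl
  intro r t σ σ' h ht
  induction h with
  | whileTrue h₀ hb h₁ _ _ _ ih =>
    cases ht
    intro hσ
    refine ih rfl (hJ _ _ hσ ?_ h₁)
    rw [bigStep_guard.1 h₀] at hb
    exact of_decide_eq_true hb
  | whileFalse h₀ hb =>
    cases ht
    intro hσ
    refine ⟨hσ, ?_⟩
    rw [bigStep_guard.1 h₀] at hb
    exact not_lt.1 (of_decide_eq_false hb)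
  | _ => cases ht

theorem bigStep_loops {t : Prog .stmt} (ht : t ∈ loops) (h : BigStep t σ σ') (hσ : σ.h 0 = 0) :
    σ'.h 0 = 2 := by
  rcases derives_of_gen ht with rfl | rfl
  -- Each body has its own invariant: `n ≤ 2` is broken by adding 2 to 1, and `n = 0 ∨ n = 2` by
  -- adding 1 to 0.
  · have := bigStep_loop_invariant (J := fun n => n ≤ 2) (fun σ σ' _ hlt hs => by
      rw [(bigStep_incr fun _ => bigStep_one).1 hs, shift_h_zero]; omega) h (by omega)
    omega
  · have := bigStep_loop_invariant (J := fun n => n = 0 ∨ n = 2) (fun σ σ' _ hlt hs => by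
      rw [(bigStep_incr fun _ => bigStep_two).1 hs, shift_h_zero]; omega) h (by omega)
    omega

/-- Which disjunct holds depends on the input state, so the choice may change between iterations. -/
theorem bigStep_mixedStep (h : BigStep mixedStep σ σ') :
    BigStep (incr one) σ σ' ∨ BigStep (incr two) σ σ' := by
  cases h with
  | iteTrue _ _ h => exact .inl h
  | iteFalse _ _ h => exact .inr h

/-- The variable `x` takes the values 0, 1, 3 and so misses the 2 on which both programs in `loops`
end. -/
theorem bigStep_loop_mixedStep (hσ : σ.h 0 = 0) :
    BigStep (loop mixedStep) σ (shift 2 (shift 1 σ)) := by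
  have hif : ∀ σ, BigStep (.node .lt (args₂ x one)) σ { σ with bt := decide (σ.h 0 < 1) } :=
    fun σ => (bigStep_lt (fun _ => bigStep_x) fun _ => bigStep_one).2 rfl
  refine .whileTrue (ts := args₂ guard mixedStep) (bigStep_guard.2 rfl) (by simp [hσ])
    (.iteTrue (hif σ) (by simp [hσ]) ((bigStep_incr fun _ => bigStep_one).2 rfl)) ?_
  refine .whileTrue (ts := args₂ guard mixedStep) (bigStep_guard.2 rfl) (by simp [hσ])
    (.iteFalse (hif _) (by simp [hσ]) ((bigStep_incr fun _ => bigStep_two).2 rfl)) ?_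
  exact .whileFalse (ts := args₂ guard mixedStep) (bigStep_guard.2 rfl) (by simp [hσ])

/-! ### Refutation of Cartesian proofs -/

/-- The context after the match on the loop: variables for the guard and for the loop body. -/
abbrev LoopVar : Srt → Type := Refine (V := TopVar .stmt) (.t : TopVar .stmt .stmt) .whileDo

def topVal (t : Prog .stmt) : Val (TopVar .stmt)
  | _, .t => t

def loopVal (s : Prog .stmt) : Val LoopVar :=
  Refine.val (topVal (loop s)) (args₂ guard s)

theorem loopVal_eq_of_not_occurs {s s' : Prog .stmt} (r : Srt) (w : LoopVar r)
    (hw : ¬ (Tm.hole (.new 1 : LoopVar .stmt)).Occurs w) : loopVal s' r w = loopVal s r w := by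
  rcases w with ⟨⟨⟩, h⟩ | i
  · exact absurd rfl h
  · match i with
    | 0 => rfl
    | 1 => exact absurd .hole hw

theorem not_cartesianProvable {I : Interpreter} (hI : I.Correct) {𝒞 : Set (Set (Prog .stmt))}
    (hC : loops ∈ 𝒞) : ¬ I.CartesianProvable 𝒞 loops {σ | σ.h 0 = 0} {σ | σ.h 0 = 2} := by
  rintro ⟨D, hD, hstart⟩
  replace hD : I.ClosedTriples 𝒞 loops D := hD
  obtain ⟨post', hU, hpost⟩ := hD _ _ _ _ _ _ hstart
  let σ : State := ⟨fun _ => 0, 0, false⟩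
  -- Correctness provides an execution on the mixed loop, although this program lies outside
  -- `loops`.
  obtain ⟨o, ts, σ', ht, he, hres⟩ :=
    (hI _ _ _ _).2 (bigStep_loop_mixedStep (σ := σ) rfl)
  cases ht
  have hsub : ∀ s, (fun r w => (Refine.sub (V := TopVar .stmt) .t .whileDo r w).subst (loopVal s))
      = topVal (loop s) := by
    intro s
    funext r w
    exact Refine.sub_subst_val (ρ := topVal (loop s)) rfl r w
  have hmem : ∀ ρ ∈ ({loopVal (incr one), loopVal (incr two)} : Set (Val LoopVar)),
      ((Tm.hole TopVar.t).subst (Refine.sub (V := TopVar .stmt) .t .whileDo)).subst ρ ∈ loops := by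
    rintro _ (rfl | rfl)
    · rw [Tm.subst_subst, hsub]; exact loop_one_mem
    · rw [Tm.subst_subst, hsub]; exact loop_two_mem
  have hmix : ∀ ρ ∈ ({loopVal (incr one), loopVal (incr two)} : Set (Val LoopVar)),
      ∀ (r : Srt) (v : LoopVar r) (y z : State), I.Returns (loopVal mixedStep r v) y z →
        ∃ ρ' ∈ ({loopVal (incr one), loopVal (incr two)} : Set (Val LoopVar)),
          I.Returns (ρ' r v) y z ∧
            ∀ q (w : LoopVar q), ¬ (Tm.hole v).Occurs w → ρ' q w = ρ q w := by
    rintro ρ hρ r v y z hr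
    rcases v with ⟨⟨⟩, h⟩ | i
    · exact absurd rfl h
    match i with
    | 0 =>
      -- The guard is common to all three loops, so no switch is needed.
      refine ⟨ρ, hρ, ?_, fun _ _ _ => rfl⟩
      rcases hρ with rfl | rfl <;> exact hr
    | 1 =>
      have hrest : ∀ s, ∀ r (w : LoopVar r), ¬ (Tm.hole (.new 1 : LoopVar .stmt)).Occurs w →
          loopVal s r w = ρ r w := by
        rcases hρ with rfl | rfl <;> exact fun s => loopVal_eq_of_not_occurs
      rcases bigStep_mixedStep ((hI _ _ _ _).1 hr) with h | h
      · exact ⟨_, .inl rfl, (hI _ _ _ _).2 h, hrest _⟩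
      · exact ⟨_, .inr rfl, (hI _ _ _ _).2 h, hrest _⟩
  have hpre : I.atEntry (Assn.refine (fun C' ρ x κ x' =>
      ρ .stmt .t ∈ C' ∧ x ∈ {σ : State | σ.h 0 = 0} ∧ x' = x ∧ κ = []) TopVar.t .whileDo)
      loops (loopVal (incr one)) σ [] (I.entry σ) := by
    refine ⟨σ, rfl, ?_⟩
    rw [Assn.refine, hsub]
    exact ⟨loop_one_mem, rfl, rfl, rfl⟩
  -- Starting from the body `incr one` is arbitrary; `incr two` would do as well.
  obtain ⟨ρ', -, hρ'⟩ := hD.deriv_mixed hC hmem hmix he (by rintro r ⟨i⟩; rfl) (hU .whileDo)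
    (.inl rfl) hpre
  have h2 : (I.result σ').h 0 = 2 := hpost _ _ _ _ hρ'
  -- The final value of `x` is 0 + 1 + 2, not 2.
  simp [← hres, σ] at h2

end CountingLoops

end CartInterp

theorem mainTheorem10 (I : CartInterp.Interpreter) (hI : I.Correct) :
    ∃ (τ : CartInterp.Srt) (C : Set (CartInterp.Prog τ)) (P Q : Set CartInterp.State),
      CartInterp.InductivelyDefined C ∧ I.TrueTriple C P Q ∧
        ∀ 𝒞 : Set (Set (CartInterp.Prog τ)), C ∈ 𝒞 → ¬ I.CartesianProvable 𝒞 C P Q :=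
  ⟨.stmt, CartInterp.CountingLoops.loops, {σ | σ.h 0 = 0}, {σ | σ.h 0 = 2},
    ⟨CartInterp.CountingLoops.grammar, .loop, rfl⟩,
    fun _ ht _ hx _ hr => CartInterp.CountingLoops.bigStep_loops ht ((hI _ _ _ _).1 hr) hx,
    fun _ hC => CartInterp.CountingLoops.not_cartesianProvable hI hC⟩
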